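/- All Hilbert spaces are complex, and operators are bounded and linear; $\mathcal R(A)$ denotes the range of $A$, and $|A|=(A^*A)^{1/2}$. For nonzero Hilbert spaces $\mathcal H_1,\mathcal H_2$, a block matrix $\begin{bmatrix} V & E\\ 0 & X\end{bmatrix}$ on $\mathcal H_1\oplus\mathcal H_2$ is called a Brownian-type operator if $V^*V=I$, $V^*E=0$ and $XE^*E=E^*EX$; it is of class $\mathscr S$ (resp. $\mathscr N$) if, moreover, $X$ is subnormal (resp. normal), and we then write that it belongs to $\mathscr S_{\mathcal H_1,\mathcal H_2}$ (resp. $\mathscr N_{\mathcal H_1,\mathcal H_2}$). Inclusions of Hilbert spaces are isometric embeddings; for operators $A$ on $\mathcal H$ and $B$ on $\mathcal K$, $A\subseteq B$ means that $\mathcal H\subseteq\mathcal K$ and $Ah=Bh$ for all $h\in\mathcal H$. A normal extension $N$ on $\mathcal K$ of an operator $S$ on $\mathcal H$ is minimal if $\mathcal K$ is the only closed subspace of $\mathcal K$ that contains $\mathcal H$ and reduces $N$. A block matrix $[\tilde A_{ij}]$ on $\mathcal K_1\oplus\mathcal K_2$ is an entrywise extension of a block matrix $[A_{ij}]$ on $\mathcal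 H_1\oplus\mathcal H_2$ if $\mathcal H_j\subseteq\mathcal K_j$ and $A_{ij}h=\tilde A_{ij}h$ for all $h\in\mathcal H_j$ and $i,j=1,2$. **Corollary 1.5.** Let $\begin{bmatrix} V & E\\ 0 & S\end{bmatrix}\in\mathscr S_{\mathcal H_1,\mathcal H_2}$ and let $N$, acting on a Hilbert space $\mathcal K_2\supseteq\mathcal H_2$, be a minimal normal extension of $S$. Then there exist a Hilbert space $\mathcal K_1$ and operators $\tilde V\colon\mathcal K_1\to\mathcal K_1$ and $\tilde E\colon\mathcal K_2\to\mathcal K_1$ such that $\begin{bmatrix}\tilde V&\tilde E\\0&N\end{bmatrix}\in\mathscr N_{\mathcal K_1,\mathcal K_2}$, this block matrix is an entrywise extension of $\begin{bmatrix}V&E\\0&S\end{bmatrix}$ (with the given inclusion $\mathcal H_2\subseteq\mathcal K_2$), $|E|\subseteq|\tilde E|$, $\dim\mathcal K_j=\dim\mathcal H_j$ for $j=1,2$ (Hilbert space dimension), and $$\mathcal K_1=\mathcal R(\tilde V)\oplus\overline{\mathcal R(\tilde E)}\quad\text{(orthogonal sum)}.$$ -/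

import Mathlib

open ContinuousLinearMap

universe u

/-! ### Hilbert dimension -/

/-- The Hilbert-space (orthogonal) dimension of a complex Hilbert space: the least cardinality of
an orthonormal basis. By `hilbertDim_eq_mk` below, it is the cardinality of every orthonormal
basis. -/
noncomputable def hilbertDim (H : Type u) [NormedAddCommGroup H] [InnerProductSpace ℂ H] :
    Cardinal.{u} :=
  sInf {c : Cardinal.{u} | ∃ ι : Type u, Nonempty (HilbertBasis ι ℂ H) ∧ Cardinal.mk ι = c}

theorem HilbertBasis.mk_le_mk {H : Type u} [NormedAddCommGroup H] [InnerProductSpace ℂ H]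
    {ι κ : Type u} (b : HilbertBasis ι ℂ H) (b' : HilbertBasis κ ℂ H) :
    Cardinal.mk ι ≤ Cardinal.mk κ := by
  cases finite_or_infinite κ with
  | inl hfin =>
    have hfd : FiniteDimensional ℂ (Submodule.span ℂ (Set.range b')) :=
      FiniteDimensional.span_of_finite ℂ (Set.finite_range b')
    have htop : Submodule.span ℂ (Set.range b') = ⊤ := by
      have h1 := b'.dense_span
      have h2 : IsClosed (Submodule.span ℂ (Set.range b') : Set H) :=
        Submodule.closed_of_finiteDimensional _
      rwa [IsClosed.submodule_topologicalClosure_eq h2] at h1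
    have h1 : Cardinal.mk ι ≤ Module.rank ℂ H :=
      b.orthonormal.linearIndependent.cardinal_le_rank
    have h2 : Module.rank ℂ H ≤ Cardinal.mk (Set.range b') := by
      rw [← rank_top ℂ H, ← htop]
      exact rank_span_le _
    exact h1.trans (h2.trans Cardinal.mk_range_le)
  | inr hinf =>
    have hc : ∀ k : κ, {i : ι | inner ℂ (b i) (b' k) ≠ 0}.Countable := by
      intro k
      have hs := (b.orthonormal.inner_products_summable (b' k)).countable_support
      refine hs.mono ?_
      intro i hi
      simpa using hi
    have hU : (⋃ k : κ, {i : ι | inner ℂ (b i) (b' k) ≠ 0}) = Set.univ := by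
      refine Set.eq_univ_of_forall fun i => ?_
      by_contra hcon
      simp only [Set.mem_iUnion, Set.mem_ofPred_eq, not_exists, not_not] at hcon
      have h0 : b'.repr (b i) = 0 := by
        ext k
        rw [b'.repr_apply_apply, ← inner_conj_symm, hcon k]
        simp
      have h1 : b i = 0 := by simpa using h0
      have h2 := b.orthonormal.norm_eq_one i
      rw [h1, norm_zero] at h2
      exact zero_ne_one h2
    have h3 : Cardinal.mk ι ≤ Cardinal.sum fun k : κ =>
        Cardinal.mk {i : ι | inner ℂ (b i) (b' k) ≠ 0} := by
      rw [← Cardinal.mk_univ, ← hU]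
      exact Cardinal.mk_iUnion_le_sum_mk
    refine h3.trans ?_
    refine (Cardinal.sum_le_sum _ (fun _ => Cardinal.aleph0) fun k => ?_).trans ?_
    · exact Cardinal.le_aleph0_iff_set_countable.mpr (hc k)
    · rw [Cardinal.sum_const']
      exact (Cardinal.mul_aleph0_eq (Cardinal.aleph0_le_mk κ)).le

theorem hilbertDim_eq_mk {H : Type u} [NormedAddCommGroup H] [InnerProductSpace ℂ H]
    {ι : Type u} (b : HilbertBasis ι ℂ H) : hilbertDim H = Cardinal.mk ι := by
  apply le_antisymm
  · exact csInf_le' ⟨ι, ⟨b⟩, rfl⟩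
  · refine le_csInf ⟨_, ι, ⟨b⟩, rfl⟩ ?_
    rintro c ⟨κ, ⟨b'⟩, rfl⟩
    exact b.mk_le_mk b'

section Operators

variable {H K H₁ H₂ K₁ K₂ : Type u}
  [NormedAddCommGroup H] [InnerProductSpace ℂ H] [CompleteSpace H]
  [NormedAddCommGroup K] [InnerProductSpace ℂ K] [CompleteSpace K]
  [NormedAddCommGroup H₁] [InnerProductSpace ℂ H₁] [CompleteSpace H₁]
  [NormedAddCommGroup H₂] [InnerProductSpace ℂ H₂] [CompleteSpace H₂]
  [NormedAddCommGroup K₁] [InnerProductSpace ℂ K₁] [CompleteSpace K₁]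
  [NormedAddCommGroup K₂] [InnerProductSpace ℂ K₂] [CompleteSpace K₂]

/-- The modulus `|E| = (E⋆E)^{1/2}` of a bounded operator `E` between Hilbert spaces, the square
root being the positive one. -/
noncomputable def opModulus (E : H →L[ℂ] K) : H →L[ℂ] H :=
  CFC.sqrt (adjoint E ∘L E)

theorem opModulus_isPositive (E : H →L[ℂ] K) : (opModulus E).IsPositive :=
  (ContinuousLinearMap.nonneg_iff_isPositive _).mp (CFC.sqrt_nonneg _)

theorem opModulus_comp_self (E : H →L[ℂ] K) :
    opModulus E ∘L opModulus E = adjoint E ∘L E :=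
  CFC.sqrt_mul_sqrt_self _
    ((ContinuousLinearMap.nonneg_iff_isPositive _).mpr E.isPositive_adjoint_comp_self)

/-! ### Extensions and subnormal operators

An inclusion `H ⊆ K` of Hilbert spaces is given by an isometric linear embedding `ι : H → K`. -/

/-- `T ⊆ S`: the operator `S` on `K` extends the operator `T` on `H`. -/
def OpExtends (ι : H →ₗᵢ[ℂ] K) (T : H →L[ℂ] H) (S : K →L[ℂ] K) : Prop :=
  ∀ h : H, S (ι h) = ι (T h)

/-- The subspace `L` reduces the operator `N`: both `L` and `Lᗮ` are invariant under `N`. -/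
def Reduces (L : Submodule ℂ K) (N : K →L[ℂ] K) : Prop :=
  (∀ x ∈ L, N x ∈ L) ∧ ∀ x ∈ Lᗮ, N x ∈ Lᗮ

/-- `N` is a normal extension of `S`. -/
def IsNormalExtension (ι : H →ₗᵢ[ℂ] K) (S : H →L[ℂ] H) (N : K →L[ℂ] K) : Prop :=
  IsStarNormal N ∧ OpExtends ι S N

/-- `N` is a minimal normal extension of `S`: a normal extension such that `K` is the only closed
subspace of `K` that contains `H` and reduces `N`. -/
def IsMinimalNormalExtension (ι : H →ₗᵢ[ℂ] K) (S : H →L[ℂ] H) (N : K →L[ℂ] K) : Prop :=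
  IsNormalExtension ι S N ∧
    ∀ L : Submodule ℂ K, IsClosed (L : Set K) → (∀ h : H, ι h ∈ L) → Reduces L N → L = ⊤

/-- `S` is subnormal: it has a normal extension on some Hilbert space. -/
def IsSubnormalOperator (S : H →L[ℂ] H) : Prop :=
  ∃ (K : Type u) (_ : NormedAddCommGroup K) (_ : InnerProductSpace ℂ K) (_ : CompleteSpace K)
    (ι : H →ₗᵢ[ℂ] K) (N : K →L[ℂ] K), IsNormalExtension ι S N

/-! ### Block matrices and Brownian-type operators -/

/-- A `2 × 2` block matrix of bounded operators, i.e. an operator on `H₁ ⊕ H₂` given through its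
entries. -/
structure BlockMatrix (H₁ H₂ : Type u)
    [NormedAddCommGroup H₁] [InnerProductSpace ℂ H₁]
    [NormedAddCommGroup H₂] [InnerProductSpace ℂ H₂] where
  e11 : H₁ →L[ℂ] H₁
  e12 : H₂ →L[ℂ] H₁
  e21 : H₁ →L[ℂ] H₂
  e22 : H₂ →L[ℂ] H₂

/-- The upper triangular block matrix with first row `V, E` and second row `0, X`. -/
def BlockMatrix.upper (V : H₁ →L[ℂ] H₁) (E : H₂ →L[ℂ] H₁) (X : H₂ →L[ℂ] H₂) :
    BlockMatrix H₁ H₂ :=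
  ⟨V, E, 0, X⟩

/-- `A` is a Brownian-type operator with respect to `H₁ ⊕ H₂`: both summands are nonzero, and `A`
has entries `V, E` in the first and `0, X` in the second row with `V` an isometry, `V⋆E = 0` and
`X E⋆E = E⋆E X`. -/
structure BlockMatrix.IsBrownianType (A : BlockMatrix H₁ H₂) : Prop where
  nontrivial_left : Nontrivial H₁
  nontrivial_right : Nontrivial H₂
  e21_eq_zero : A.e21 = 0
  isometry : adjoint A.e11 ∘L A.e11 = ContinuousLinearMap.id ℂ H₁
  orthogonal : adjoint A.e11 ∘L A.e12 = 0
  commute : A.e22 ∘L (adjoint A.e12 ∘L A.e12) = (adjoint A.e12 ∘L A.e12) ∘L A.e22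

/-- Brownian-type operators of class `𝒮`: the lower right entry is subnormal. -/
def BlockMatrix.IsClassS (A : BlockMatrix H₁ H₂) : Prop :=
  A.IsBrownianType ∧ IsSubnormalOperator A.e22

/-- Brownian-type operators of class `𝒩`: the lower right entry is normal. -/
def BlockMatrix.IsClassN (A : BlockMatrix H₁ H₂) : Prop :=
  A.IsBrownianType ∧ IsStarNormal A.e22

/-- `A ≼ B`: the block matrix `B` on `K₁ ⊕ K₂` is an entrywise extension of the block matrix `A`
on `H₁ ⊕ H₂`, relative to the inclusions `H₁ ⊆ K₁` and `H₂ ⊆ K₂`. -/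
structure BlockMatrix.EntrywiseExtends (ι₁ : H₁ →ₗᵢ[ℂ] K₁) (ι₂ : H₂ →ₗᵢ[ℂ] K₂)
    (A : BlockMatrix H₁ H₂) (B : BlockMatrix K₁ K₂) : Prop where
  e11 : ∀ h : H₁, B.e11 (ι₁ h) = ι₁ (A.e11 h)
  e12 : ∀ h : H₂, B.e12 (ι₂ h) = ι₁ (A.e12 h)
  e21 : ∀ h : H₁, B.e21 (ι₁ h) = ι₂ (A.e21 h)
  e22 : ∀ h : H₂, B.e22 (ι₂ h) = ι₂ (A.e22 h)

/-- `H = M ⊕ L`, the orthogonal direct sum of two subspaces. -/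
def IsOrthogonalSum (M L : Submodule ℂ H) : Prop :=
  M ⟂ L ∧ M ⊔ L = ⊤

end Operators

/-! The modulus of E is lifted before E itself. Since |E| commutes with S, it lifts to a positive Q
on K₂ commuting with N (`IsMinimalNormalExtension.exists_lift`, `exists_lift_opModulus`): the
vectors N*ⁿh with h in H₂ span a dense subspace, their inner products involve S alone, and Q sends
N*ⁿh to N*ⁿ|E|h.

Any Ẽ with |Ẽ| = Q satisfies the commutation condition. Let W be the partial isometry with WQh = Eh
on H₂ (`exists_partialIsometry`), D = I − W*W, M = ker V* ∩ ker E*, and R the closure of the range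
of DQ. On K₁ = H₁ ⊕ ℓ²(M) ⊕ ℓ²(R) put Ẽy = (WQy, 0, δ₀DQy). This extends E because DQ vanishes on
H₂, and |Ẽ| = Q by Pythagoras. Let Ṽ be V on H₁, the forward shift on ℓ²(R), and on ℓ²(M) the
backward shift, whose lost zeroth coordinate is sent to M ⊆ H₁. So M, the part of H₁ orthogonal to
both old ranges, is absorbed into the range of Ṽ, and the rest of ker Ṽ* is the closure of the range
of Ẽ (`isOrthogonalSum_range`).

Infinite dimensions agree because countably many operators from the smaller space have jointly total
range (`hilbertDim_le_of_isTotalFamily`). If H₂ is finite-dimensional, S is already normal and K₂ =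
H₂; if H₁ is, V is unitary, E = 0 and nothing is added. -/

set_option linter.unusedSectionVars false

/-! ### Hilbert dimension and total families of operators -/

section Dimension

variable {H K : Type u}
  [NormedAddCommGroup H] [InnerProductSpace ℂ H] [CompleteSpace H]
  [NormedAddCommGroup K] [InnerProductSpace ℂ K] [CompleteSpace K]

/-- A family of operators into `K` is total if only `0` is orthogonal to all of their ranges. -/
def IsTotalFamily {α : Type*} (T : α → H →L[ℂ] K) : Prop :=
  ∀ z : K, (∀ a h, inner ℂ (T a h) z = 0) → z = 0

theorem IsTotalFamily.ext {α : Type*} {T : α → H →L[ℂ] K} (hT : IsTotalFamily T)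
    {L : Type*} [NormedAddCommGroup L] [InnerProductSpace ℂ L] [CompleteSpace L]
    {A B : K →L[ℂ] L} (h : ∀ a x, A (T a x) = B (T a x)) : A = B := by
  ext z
  rw [← sub_eq_zero, ← inner_self_eq_zero (𝕜 := ℂ)]
  have : adjoint (A - B) (A z - B z) = 0 := by
    refine hT _ fun a x => ?_
    rw [adjoint_inner_right, sub_apply, h, sub_self, inner_zero_left]
  rw [← sub_apply, ← adjoint_inner_left, sub_apply, this, inner_zero_left]


theorem hilbertDim_congr (e : H ≃ₗᵢ[ℂ] K) : hilbertDim H = hilbertDim K := by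
  unfold hilbertDim
  congr 1
  ext c
  constructor
  · rintro ⟨ι, ⟨b⟩, rfl⟩
    exact ⟨ι, ⟨⟨e.symm.trans b.repr⟩⟩, rfl⟩
  · rintro ⟨ι, ⟨b⟩, rfl⟩
    exact ⟨ι, ⟨⟨e.trans b.repr⟩⟩, rfl⟩

/-- Each basis vector of K has a nonzero coefficient in some T a (b j), and each such vector has
only countably many, so a basis of K has at most |α| · dim H · ℵ₀ = dim H elements. -/
theorem hilbertDim_le_of_isTotalFamily {α : Type} [Countable α] {T : α → H →L[ℂ] K}
    (hT : IsTotalFamily T) (hH : Cardinal.aleph0 ≤ hilbertDim H) :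
    hilbertDim K ≤ hilbertDim H := by
  obtain ⟨s, b, -⟩ := exists_hilbertBasis ℂ H
  obtain ⟨t, b', -⟩ := exists_hilbertBasis ℂ K
  rw [hilbertDim_eq_mk b] at hH ⊢
  rw [hilbertDim_eq_mk b']
  have hc : ∀ p : α × s, {k : t | inner ℂ (b' k) (T p.1 (b p.2)) ≠ 0}.Countable := by
    intro p
    refine (b'.orthonormal.inner_products_summable (T p.1 (b p.2))).countable_support.mono ?_
    intro i hi
    simpa using hi
  have hU : (⋃ p : α × s, {k : t | inner ℂ (b' k) (T p.1 (b p.2)) ≠ 0}) = Set.univ := by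
    refine Set.eq_univ_of_forall fun k => ?_
    by_contra hcon
    simp only [Set.mem_iUnion, Set.mem_ofPred_eq, not_exists, not_not] at hcon
    have h1 : b' k = 0 := by
      refine hT _ fun a h => ?_
      have h2 : adjoint (T a) (b' k) = 0 := by
        have : b.repr (adjoint (T a) (b' k)) = 0 := by
          ext j
          rw [b.repr_apply_apply, adjoint_inner_right, ← inner_conj_symm, hcon (a, j)]
          simp
        simpa using this
      rw [← adjoint_inner_right, h2, inner_zero_right]
    have h2 := b'.orthonormal.norm_eq_one k
    rw [h1, norm_zero] at h2
    exact zero_ne_one h2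
  have h3 : Cardinal.mk t ≤ Cardinal.sum fun p : α × s =>
      Cardinal.mk {k : t | inner ℂ (b' k) (T p.1 (b p.2)) ≠ 0} := by
    rw [← Cardinal.mk_univ, ← hU]
    simpa using Cardinal.mk_iUnion_le_sum_mk_lift
      (f := fun p : α × s => {k : t | inner ℂ (b' k) (T p.1 (b p.2)) ≠ 0})
  refine h3.trans ((Cardinal.sum_le_sum _ (fun _ => Cardinal.aleph0) fun p => ?_).trans ?_)
  · exact Cardinal.le_aleph0_iff_set_countable.mpr (hc p)
  · rw [Cardinal.sum_const, Cardinal.lift_id', Cardinal.lift_aleph0, Cardinal.mk_prod,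
      Cardinal.lift_id'.{0, u}, mul_assoc]
    refine (mul_le_mul' ?_ (Cardinal.mul_aleph0_eq hH).le).trans
      (Cardinal.aleph0_mul_eq hH).le
    rw [Cardinal.lift_le_aleph0]
    exact Cardinal.mk_le_aleph0

theorem finiteDimensional_of_hilbertDim_lt (h : hilbertDim H < Cardinal.aleph0) :
    FiniteDimensional ℂ H := by
  obtain ⟨s, b, -⟩ := exists_hilbertBasis ℂ H
  rw [hilbertDim_eq_mk b, Cardinal.lt_aleph0_iff_finite] at h
  have := Fintype.ofFinite s
  exact b.toOrthonormalBasis.toBasis.finiteDimensional_of_finite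

theorem hilbertDim_le_of_isometry (ι : H →ₗᵢ[ℂ] K) : hilbertDim H ≤ hilbertDim K := by
  obtain ⟨s, b, -⟩ := exists_hilbertBasis ℂ H
  have ho : Orthonormal ℂ (fun i : s => ι (b i)) := b.orthonormal.comp_linearIsometry ι
  obtain ⟨w, b', hw, hb⟩ := ho.toSubtypeRange.exists_hilbertBasis_extension
  rw [hilbertDim_eq_mk b, hilbertDim_eq_mk b']
  rw [← Cardinal.mk_range_eq _ ho.linearIndependent.injective]
  exact Cardinal.mk_le_mk_of_subset hw

end Dimension

/-! ### Partial isometries intertwining two maps with equal norms -/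

section PartialIsometry

variable {X Y Z : Type*}
  [NormedAddCommGroup X] [InnerProductSpace ℂ X]
  [NormedAddCommGroup Y] [InnerProductSpace ℂ Y] [CompleteSpace Y]
  [NormedAddCommGroup Z] [InnerProductSpace ℂ Z] [CompleteSpace Z]

/-- The map A x ↦ B x is isometric on the range of A; it extends to the closure by continuity and to
Y by zero on the orthogonal complement. The last clause says that the final space is the closure of
the range of B. -/
theorem exists_partialIsometry (A : X →L[ℂ] Y) (B : X →L[ℂ] Z) (h : ∀ x, ‖B x‖ = ‖A x‖) :
    ∃ W : Y →L[ℂ] Z, (∀ x, W (A x) = B x) ∧ (∀ x, adjoint W (B x) = A x) ∧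
      (∀ y, W (adjoint W (W y)) = W y) ∧ ∀ z, (∀ x, inner ℂ (B x) z = 0) → adjoint W z = 0 := by
  set L : Submodule ℂ Y := (LinearMap.range A.toLinearMap).topologicalClosure
  have hmem : ∀ x, A x ∈ L := fun x => Submodule.le_topologicalClosure _ ⟨x, rfl⟩
  have : CompleteSpace L := (Submodule.isClosed_topologicalClosure _).completeSpace_coe
  let A' : X →ₗ[ℂ] L := A.toLinearMap.codRestrict L hmem
  have hd : DenseRange A' := by
    intro y
    rw [closure_subtype]
    refine closure_mono ?_ (show (y : Y) ∈ closure _ from y.2)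
    rintro _ ⟨x, rfl⟩
    exact ⟨A' x, ⟨x, rfl⟩, rfl⟩
  let T₀ : L →L[ℂ] Z := B.toLinearMap.extendOfNorm A'
  have hT₀ : ∀ x, T₀ (A' x) = B x :=
    LinearMap.extendOfNorm_eq hd ⟨1, fun x => by rw [one_mul]; exact (h x).le⟩
  have hiso : ∀ y, ‖T₀ y‖ = ‖y‖ := by
    intro y
    refine hd.induction_on (p := fun y => ‖T₀ y‖ = ‖y‖) y
      (isClosed_eq (by fun_prop) (by fun_prop)) fun x => ?_
    rw [hT₀]
    exact h x
  let T₁ : L →ₗᵢ[ℂ] Z := ⟨T₀.toLinearMap, hiso⟩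
  have hin : ∀ a b : L, inner ℂ (T₀ a) (T₀ b) = inner ℂ a b := T₁.inner_map_map
  let P : Y →L[ℂ] L := L.orthogonalProjectionOnto
  have hP : ∀ a : L, P a = a := fun a => Submodule.orthogonalProjectionOnto_mem_subspace_eq_self a
  have hPi : ∀ (a : L) (y : Y), inner ℂ a (P y) = inner ℂ (a : Y) y := fun a y =>
    Submodule.inner_orthogonalProjectionOnto_eq_of_mem_left a y
  have hWW : ∀ a : L, adjoint (T₀ ∘L P) (T₀ a) = a := by
    intro a
    refine ext_inner_right ℂ fun y => ?_
    rw [adjoint_inner_left, comp_apply, hin, hPi]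
  refine ⟨T₀ ∘L P, fun x => ?_, fun x => ?_, fun y => ?_, fun z hz => ?_⟩
  · rw [comp_apply, ← hT₀]
    exact congrArg T₀ (hP (A' x))
  · rw [← hT₀, hWW]
    rfl
  · rw [comp_apply T₀ P y, hWW, comp_apply, hP]
  · refine ext_inner_left ℂ fun y => ?_
    rw [adjoint_inner_right, inner_zero_right, comp_apply]
    refine hd.induction_on (p := fun l => inner ℂ (T₀ l) z = 0) (P y)
      (isClosed_eq (by fun_prop) (by fun_prop)) fun x => ?_
    rw [hT₀, hz]

theorem norm_sq_add_norm_sq_of_partialIsometry {W : Y →L[ℂ] Z}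
    (hW : ∀ y, W (adjoint W (W y)) = W y) (y : Y) :
    inner ℂ (W y) (W y) + inner ℂ (y - adjoint W (W y)) (y - adjoint W (W y)) =
      (inner ℂ y y : ℂ) := by
  simp only [inner_sub_left, inner_sub_right, adjoint_inner_left, adjoint_inner_right, map_sub, hW,
    sub_self, inner_zero_left]
  ring

end PartialIsometry

/-! ### Minimal normal extensions -/

section NormalExtension

variable {H K : Type u}
  [NormedAddCommGroup H] [InnerProductSpace ℂ H] [CompleteSpace H]
  [NormedAddCommGroup K] [InnerProductSpace ℂ K] [CompleteSpace K]
  {ι : H →ₗᵢ[ℂ] K} {S : H →L[ℂ] H} {N : K →L[ℂ] K}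

theorem OpExtends.pow (h : OpExtends ι S N) (n : ℕ) (x : H) :
    (N ^ n) (ι x) = ι ((S ^ n) x) := by
  induction n with
  | zero => simp
  | succ n ih => rw [pow_succ', pow_succ', mul_apply_eq_comp, mul_apply_eq_comp, ih, h]

theorem IsNormalExtension.apply_adjoint_pow (h : IsNormalExtension ι S N) (n : ℕ) (x : H) :
    N ((adjoint N ^ n) (ι x)) = (adjoint N ^ n) (ι (S x)) := by
  have hc : Commute N (adjoint N ^ n) := by
    have := h.1.star_comm_self
    exact (Commute.symm this).pow_right n
  have := congrArg (fun T : K →L[ℂ] K => T (ι x)) hc.eq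
  simpa [h.2 x] using this

/-- The vectors orthogonal to all N*ⁿh form a subspace `G` invariant under N and N*, so its
complement is closed, reducing and contains H; minimality makes that complement everything. -/
theorem IsMinimalNormalExtension.isTotalFamily (h : IsMinimalNormalExtension ι S N) :
    IsTotalFamily fun n : ℕ => (adjoint N ^ n) ∘L ι.toContinuousLinearMap := by
  let G : Submodule ℂ K :=
    { carrier := {z | ∀ (n : ℕ) (x : H), inner ℂ ((adjoint N ^ n) (ι x)) z = 0}
      add_mem' := fun ha hb n x => by rw [inner_add_right, ha, hb, add_zero]
      zero_mem' := fun n x => inner_zero_right _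
      smul_mem' := fun c a ha n x => by rw [inner_smul_right, ha, mul_zero] }
  have hG : ∀ z ∈ G, N z ∈ G := fun z hz n x => by
    rw [← adjoint_inner_left, ← mul_apply_eq_comp, ← pow_succ']
    exact hz _ _
  have hG' : ∀ z ∈ G, adjoint N z ∈ G := fun z hz n x => by
    rw [adjoint_inner_right, h.1.apply_adjoint_pow]
    exact hz _ _
  have htop : Gᗮ = ⊤ := by
    refine h.2 _ (Submodule.isClosed_orthogonal _) (fun x => ?_) ⟨fun x hx => ?_, fun x hx => ?_⟩
    · rw [Submodule.mem_orthogonal']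
      intro z hz
      simpa using hz 0 x
    · rw [Submodule.mem_orthogonal] at hx ⊢
      intro z hz
      rw [← adjoint_inner_left]
      exact hx _ (hG' z hz)
    · rw [Submodule.mem_orthogonal] at hx ⊢
      intro y hy
      rw [← adjoint_inner_left]
      refine hx _ ?_
      rw [Submodule.mem_orthogonal] at hy ⊢
      intro z hz
      rw [adjoint_inner_right]
      exact hy _ (hG z hz)
  intro z hz
  have hz' : z ∈ G := fun n x => hz n x
  rw [← inner_self_eq_zero (𝕜 := ℂ)]
  have : z ∈ Gᗮ := htop ▸ Submodule.mem_top
  exact (Submodule.mem_orthogonal _ _).mp this z hz'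

theorem IsNormalExtension.norm_adjoint_apply (h : IsNormalExtension ι S N) (x : K) :
    ‖adjoint N x‖ = ‖N x‖ := by
  have := h.1
  exact (ContinuousLinearMap.isStarNormal_iff_norm_eq_adjoint.mp this x).symm

/-- A finite-dimensional operator is normal as soon as it is subnormal, so that it is its own
minimal normal extension. -/
theorem IsMinimalNormalExtension.surjective [FiniteDimensional ℂ H]
    (h : IsMinimalNormalExtension ι S N) : Function.Surjective ι := by
  set J : H →L[ℂ] K := ι.toContinuousLinearMap
  have hJi : ∀ x y, inner ℂ (J x) (J y) = inner ℂ x y := ι.inner_map_map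
  have hJJ : ∀ x, adjoint J (J x) = x := fun x =>
    ext_inner_right ℂ fun y => by rw [adjoint_inner_left, hJi]
  have hS : ∀ x, adjoint J (adjoint N (J x)) = adjoint S x := fun x =>
    ext_inner_right ℂ fun y => by
      rw [adjoint_inner_left, adjoint_inner_left, adjoint_inner_left]
      exact (congrArg _ (h.1.2 y)).trans (hJi _ _)
  let b := stdOrthonormalBasis ℂ H
  -- Pythagoras: S*x is the component in H of N*x, and ‖N*x‖ = ‖Nx‖ = ‖Sx‖.
  have h1 : ∀ x, ‖S x‖ ^ 2 = ‖adjoint S x‖ ^ 2 + ‖adjoint N (J x) - J (adjoint S x)‖ ^ 2 := by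
    intro x
    have e1 : ‖S x‖ = ‖adjoint N (J x)‖ := by
      rw [h.1.norm_adjoint_apply, ← ι.norm_map]
      exact congrArg norm (h.1.2 x).symm
    have e2 := norm_add_sq_eq_norm_sq_add_norm_sq_of_inner_eq_zero (𝕜 := ℂ) (J (adjoint S x))
      (adjoint N (J x) - J (adjoint S x))
      (by rw [← adjoint_inner_right, map_sub, hS, hJJ, sub_self, inner_zero_right])
    rw [add_sub_cancel] at e2
    rw [e1, sq, e2, show ‖J (adjoint S x)‖ = ‖adjoint S x‖ from ι.norm_map _, sq, sq]
  -- S and S* have the same Hilbert–Schmidt norm, so summing `h1` over the basis forces every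
  -- remainder to vanish: N* leaves H invariant.
  have h2 : ∑ i, ‖S (b i)‖ ^ 2 = ∑ i, ‖adjoint S (b i)‖ ^ 2 := by
    simp_rw [← b.sum_sq_norm_inner_right]
    rw [Finset.sum_comm]
    refine Finset.sum_congr rfl fun i _ => Finset.sum_congr rfl fun j _ => ?_
    rw [adjoint_inner_right, norm_inner_symm]
  have h3 : ∀ i, adjoint N (J (b i)) = J (adjoint S (b i)) := by
    have : ∑ i, ‖adjoint N (J (b i)) - J (adjoint S (b i))‖ ^ 2 = 0 := by
      rw [Finset.sum_congr rfl fun i _ => h1 (b i), Finset.sum_add_distrib] at h2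
      linarith
    rw [Finset.sum_eq_zero_iff_of_nonneg fun _ _ => by positivity] at this
    intro i
    have := this i (Finset.mem_univ i)
    rwa [sq_eq_zero_iff, norm_eq_zero, sub_eq_zero] at this
  have h4 : ∀ x, adjoint N (J x) = J (adjoint S x) := by
    have : (adjoint N ∘L J).toLinearMap = (J ∘L adjoint S).toLinearMap :=
      b.toBasis.ext fun i => by simpa using h3 i
    exact fun x => congrArg (fun T : H →ₗ[ℂ] K => T x) this
  have h5 : LinearMap.range ι.toLinearMap = ⊤ := by
    refine h.2 _ (Submodule.closed_of_finiteDimensional _) (fun x => ⟨x, rfl⟩) ⟨?_, ?_⟩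
    · rintro _ ⟨x, rfl⟩
      exact ⟨S x, (h.1.2 x).symm⟩
    · intro y hy
      rw [Submodule.mem_orthogonal] at hy ⊢
      rintro _ ⟨x, rfl⟩
      rw [← adjoint_inner_left]
      exact hy _ ⟨adjoint S x, (h4 x).symm⟩
  exact LinearMap.range_eq_top.mp h5

theorem IsMinimalNormalExtension.hilbertDim_eq (h : IsMinimalNormalExtension ι S N) :
    hilbertDim K = hilbertDim H := by
  rcases lt_or_ge (hilbertDim H) Cardinal.aleph0 with hlt | hge
  · have := finiteDimensional_of_hilbertDim_lt hlt
    exact (hilbertDim_congr (LinearIsometryEquiv.ofSurjective ι h.surjective)).symm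
  · exact (hilbertDim_le_of_isTotalFamily h.isTotalFamily hge).antisymm
      (hilbertDim_le_of_isometry ι)

/-- The right-hand side does not mention N, which is what allows operators on H commuting with S to
be transported to K. -/
theorem inner_adjoint_pow_adjoint_pow (h : IsNormalExtension ι S N) (n m : ℕ) (x y : H) :
    inner ℂ ((adjoint N ^ n) (ι x)) ((adjoint N ^ m) (ι y)) =
      (inner ℂ ((S ^ m) x) ((S ^ n) y) : ℂ) := by
  have hp : ∀ k, adjoint N ^ k = adjoint (N ^ k) := fun k => (star_pow N k).symm
  have hc : Commute (N ^ n) (adjoint N ^ m) := by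
    have := h.1.star_comm_self
    exact (Commute.symm this).pow_pow n m
  have hc' := congrArg (fun T : K →L[ℂ] K => T (ι y)) hc.eq
  simp only [mul_apply_eq_comp] at hc'
  rw [hp n, adjoint_inner_left, hc', hp m, adjoint_inner_right, h.2.pow, h.2.pow,
    ι.inner_map_map]

theorem IsSelfAdjoint.inner_apply_comm {T : H →L[ℂ] H} (hT : IsSelfAdjoint T) (x y : H) :
    inner ℂ (T x) y = (inner ℂ x (T y) : ℂ) := by
  rw [← adjoint_inner_left, hT.adjoint_eq]

/-- R is the square root of ‖q‖² − q². An algebraic identity between operators commuting with S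
passes to the formal sums of vectors N*ⁿh, and there it yields the norm bound for the lift of q. -/
theorem exists_sq_add_sq_eq {q : H →L[ℂ] H} (hq : IsSelfAdjoint q) (hc : Commute q S) :
    ∃ R : H →L[ℂ] H, IsSelfAdjoint R ∧ Commute R S ∧
      q * q + R * R = ((‖q‖ ^ 2 : ℝ) : ℂ) • (1 : H →L[ℂ] H) := by
  set a : H →L[ℂ] H := ((‖q‖ ^ 2 : ℝ) : ℂ) • 1 - q * q with ha
  have hsa : IsSelfAdjoint a := by
    refine IsSelfAdjoint.sub ?_ ?_
    · exact IsSelfAdjoint.smul (Complex.conj_ofReal _) (IsSelfAdjoint.one _)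
    · simpa [hq.star_eq] using IsSelfAdjoint.star_mul_self q
  have hpos : 0 ≤ a := by
    rw [nonneg_iff_isPositive, isPositive_def]
    refine ⟨hsa.isSymmetric, fun x => ?_⟩
    have h1 : ‖q x‖ ^ 2 ≤ ‖q‖ ^ 2 * ‖x‖ ^ 2 := by
      rw [← mul_pow]
      exact pow_le_pow_left₀ (norm_nonneg _) (q.le_opNorm x) 2
    have h2 : (inner ℂ (q (q x)) x : ℂ) = ((‖q x‖ ^ 2 : ℝ) : ℂ) := by
      rw [hq.inner_apply_comm, inner_self_eq_norm_sq_to_K]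
      norm_cast
    have h3 : (inner ℂ (a x) x : ℂ) = ((‖q‖ ^ 2 * ‖x‖ ^ 2 - ‖q x‖ ^ 2 : ℝ) : ℂ) := by
      rw [ha, sub_apply, inner_sub_left, mul_apply_eq_comp, h2, smul_apply, one_apply_eq_self,
        inner_smul_left,
        inner_self_eq_norm_sq_to_K, Complex.conj_ofReal]
      push_cast
      rfl
    rw [reApplyInnerSelf_apply, h3, RCLike.re_eq_complex_re, Complex.ofReal_re]
    linarith
  refine ⟨CFC.sqrt a, (CFC.sqrt_nonneg a).isSelfAdjoint, ?_, ?_⟩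
  · refine Commute.cfcₙ_nnreal ?_ _
    exact ((Commute.one_left S).smul_left _).sub_left (hc.mul_left hc)
  · rw [CFC.sqrt_mul_sqrt_self a hpos, ha]
    abel

/-- A selfadjoint operator commuting with `S` lifts to a selfadjoint operator commuting with a
minimal normal extension of `S`. -/
theorem IsMinimalNormalExtension.exists_lift (h : IsMinimalNormalExtension ι S N)
    {q : H →L[ℂ] H} (hq : IsSelfAdjoint q) (hc : Commute q S) :
    ∃ Q : K →L[ℂ] K, IsSelfAdjoint Q ∧ Commute Q N ∧ OpExtends ι q Q := by
  have hcp : ∀ {T : H →L[ℂ] H}, Commute T S → ∀ (n : ℕ) (x : H),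
      (S ^ n) (T x) = T ((S ^ n) x) := fun hT n x =>
    congrArg (fun T : H →L[ℂ] H => T x) (hT.pow_right n).eq.symm
  -- Formal sums are used because the lift is not yet known to be well defined on their values in K;
  -- `hbound` settles both this and continuity.
  let A : (ℕ →₀ H) →ₗ[ℂ] K :=
    Finsupp.lsum ℂ fun n => ((adjoint N ^ n) ∘L ι.toContinuousLinearMap).toLinearMap
  have hAs : ∀ n x, A (Finsupp.single n x) = (adjoint N ^ n) (ι x) := fun n x => by
    rw [Finsupp.lsum_single]
    rfl
  let M : (H →L[ℂ] H) → (ℕ →₀ H) →ₗ[ℂ] (ℕ →₀ H) := fun T =>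
    Finsupp.mapRange.linearMap T.toLinearMap
  have hMs : ∀ T n x, M T (Finsupp.single n x) = Finsupp.single n (T x) := fun T n x => by
    simp [M]
  have hd : DenseRange A := by
    have : (LinearMap.range A).topologicalClosure = ⊤ := by
      rw [Submodule.topologicalClosure_eq_top_iff, Submodule.eq_bot_iff]
      intro z hz
      refine h.isTotalFamily z fun n x => ?_
      exact (Submodule.mem_orthogonal _ _).mp hz _ ⟨Finsupp.single n x, hAs n x⟩
    intro z
    have hz : z ∈ (LinearMap.range A).topologicalClosure := this ▸ Submodule.mem_top
    exact hz
  have hsymm : ∀ {T : H →L[ℂ] H}, IsSelfAdjoint T → Commute T S → ∀ f g,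
      inner ℂ (A (M T f)) (A g) = (inner ℂ (A f) (A (M T g)) : ℂ) := by
    intro T hT hTS f g
    induction f using Finsupp.induction_linear with
    | zero => simp
    | add f₁ f₂ h₁ h₂ => simp only [map_add, inner_add_left, h₁, h₂]
    | single n x =>
      induction g using Finsupp.induction_linear with
      | zero => simp
      | add g₁ g₂ h₁ h₂ => simp only [map_add, inner_add_right, h₁, h₂]
      | single m y =>
        rw [hMs, hMs, hAs, hAs, hAs, hAs, inner_adjoint_pow_adjoint_pow h.1,
          inner_adjoint_pow_adjoint_pow h.1, hcp hTS, hcp hTS, hT.inner_apply_comm]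
  obtain ⟨R, hR, hRS, hqR⟩ := exists_sq_add_sq_eq hq hc
  have hMM : ∀ f, M q (M q f) + M R (M R f) = ((‖q‖ ^ 2 : ℝ) : ℂ) • f := by
    intro f
    ext n
    have := congrArg (fun T : H →L[ℂ] H => T (f n)) hqR
    simpa [M] using this
  have hbound : ∀ f, ‖A (M q f)‖ ≤ ‖q‖ * ‖A f‖ := by
    intro f
    have h1 : (inner ℂ (A (M q f)) (A (M q f)) : ℂ) + inner ℂ (A (M R f)) (A (M R f)) =
        ((‖q‖ ^ 2 : ℝ) : ℂ) * inner ℂ (A f) (A f) := by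
      rw [hsymm hq hc, hsymm hR hRS, ← inner_add_right, ← map_add, hMM, map_smul,
        inner_smul_right]
    simp only [inner_self_eq_norm_sq_to_K] at h1
    have h2 : ‖A (M q f)‖ ^ 2 + ‖A (M R f)‖ ^ 2 = ‖q‖ ^ 2 * ‖A f‖ ^ 2 := by
      apply Complex.ofReal_injective
      push_cast
      simpa using h1
    refine (sq_le_sq₀ (norm_nonneg _) (by positivity)).mp ?_
    rw [mul_pow, ← h2]
    exact le_add_of_nonneg_right (by positivity)
  let Q : K →L[ℂ] K := (A ∘ₗ M q).extendOfNorm A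
  have hQ : ∀ f, Q (A f) = A (M q f) := LinearMap.extendOfNorm_eq hd ⟨_, hbound⟩
  have hQs : ∀ n x, Q ((adjoint N ^ n) (ι x)) = (adjoint N ^ n) (ι (q x)) := fun n x => by
    rw [← hAs, hQ, hMs, hAs]
  refine ⟨Q, ?_, ?_, fun x => by simpa using hQs 0 x⟩
  · rw [isSelfAdjoint_iff']
    refine h.isTotalFamily.ext fun n x => ?_
    rw [← sub_eq_zero]
    refine h.isTotalFamily _ fun m y => ?_
    simp only [comp_apply, LinearIsometry.coe_toContinuousLinearMap]
    rw [inner_sub_right, adjoint_inner_right, hQs, hQs, inner_adjoint_pow_adjoint_pow h.1,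
      inner_adjoint_pow_adjoint_pow h.1, hcp hc, hcp hc, hq.inner_apply_comm, sub_self]
  · refine h.isTotalFamily.ext fun n x => ?_
    simp only [comp_apply, LinearIsometry.coe_toContinuousLinearMap]
    rw [mul_apply_eq_comp, mul_apply_eq_comp, h.1.apply_adjoint_pow, hQs, hQs,
      h.1.apply_adjoint_pow]
    exact congrArg (fun y => (adjoint N ^ n) (ι y)) (hcp hc 1 x).symm

end NormalExtension

/-! ### Shifts and orthogonal sums -/

section Spaces

theorem exists_orthogonalFamily_shift (M : Type u) [NormedAddCommGroup M] [InnerProductSpace ℂ M]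
    [CompleteSpace M] :
    ∃ (L : Type u) (_ : NormedAddCommGroup L) (_ : InnerProductSpace ℂ L) (_ : CompleteSpace L)
      (σ : ℕ → M →ₗᵢ[ℂ] L), OrthogonalFamily ℂ (fun _ : ℕ => M) σ ∧
      IsTotalFamily (fun n => (σ n).toContinuousLinearMap) ∧
      ∃ s : L →ₗᵢ[ℂ] L, ∀ n x, s (σ n x) = σ (n + 1) x := by
  let σ : ℕ → M →ₗᵢ[ℂ] lp (fun _ : ℕ => M) 2 := fun n =>
    ⟨lp.lsingle (E := fun _ : ℕ => M) (𝕜 := ℂ) 2 n, fun x =>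
      lp.norm_single (E := fun _ : ℕ => M) (p := 2) two_pos n x⟩
  have hin : ∀ n x (z : lp (fun _ : ℕ => M) 2), inner ℂ (σ n x) z = (inner ℂ x (z n) : ℂ) :=
    fun n x z => lp.inner_single_left (G := fun _ : ℕ => M) n x z
  have hσ : OrthogonalFamily ℂ (fun _ : ℕ => M) σ := by
    intro i j hij x y
    have h0 : σ j y i = 0 := lp.single_apply_ne (E := fun _ : ℕ => M) 2 j y hij
    rw [hin, h0, inner_zero_right]
  refine ⟨lp (fun _ : ℕ => M) 2, inferInstance, inferInstance, inferInstance, σ, hσ,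
    fun z hz => ?_, (hσ.comp Nat.succ_injective).linearIsometry, fun n x => ?_⟩
  · ext n
    refine ext_inner_left ℂ fun x => ?_
    rw [← hin, lp.coeFn_zero, Pi.zero_apply, inner_zero_right]
    exact hz n x
  · exact (hσ.comp Nat.succ_injective).linearIsometry_apply_single x

/-- The unilateral shift on ℓ²(ℕ, M), reduced to the operator identities used in the construction.
-/
theorem exists_shift (M : Type u) [NormedAddCommGroup M] [InnerProductSpace ℂ M]
    [CompleteSpace M] :
    ∃ (L : Type u) (_ : NormedAddCommGroup L) (_ : InnerProductSpace ℂ L) (_ : CompleteSpace L)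
      (s : L →L[ℂ] L) (e : ℕ → M →L[ℂ] L), IsTotalFamily e ∧
      (∀ z, adjoint s (s z) = z) ∧ (∀ n x, adjoint (e n) (e n x) = x) ∧
      (∀ x, adjoint s (e 0 x) = 0) ∧ (∀ z, s (adjoint s z) + e 0 (adjoint (e 0) z) = z) := by
  obtain ⟨L, _, _, _, σ, hσ, he, s', hs'⟩ := exists_orthogonalFamily_shift M
  let e : ℕ → M →L[ℂ] L := fun n => (σ n).toContinuousLinearMap
  let s : L →L[ℂ] L := s'.toContinuousLinearMap
  have hse : ∀ n x, s (e n x) = e (n + 1) x := hs'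
  have hss : ∀ z, adjoint s (s z) = z := fun z => ext_inner_right ℂ fun w => by
    rw [adjoint_inner_left]
    exact LinearIsometry.inner_map_map _ _ _
  have hee : ∀ n x, adjoint (e n) (e n x) = x := fun n x => ext_inner_right ℂ fun w => by
    rw [adjoint_inner_left]
    exact LinearIsometry.inner_map_map _ _ _
  have hs0 : ∀ x, adjoint s (e 0 x) = 0 := fun x => by
    refine he _ fun n y => ?_
    rw [adjoint_inner_right, hse]
    exact hσ (Nat.succ_ne_zero n) y x
  have h0s : ∀ z, adjoint (e 0) (s z) = 0 := fun z => ext_inner_right ℂ fun w => by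
    rw [adjoint_inner_left, ← adjoint_inner_right, hs0, inner_zero_right, inner_zero_left]
  refine ⟨L, inferInstance, inferInstance, inferInstance, s, e, he, hss, hee, hs0, fun z => ?_⟩
  rw [← sub_eq_zero]
  refine he _ fun n x => ?_
  cases n with
  | zero =>
    rw [← adjoint_inner_right, map_sub, map_add, h0s, hee, zero_add, sub_self, inner_zero_right]
  | succ n =>
    rw [← hse, ← adjoint_inner_right, map_sub, map_add, hs0, hss, add_zero, sub_self,
      inner_zero_right]

theorem exists_orthogonalSum (X Y : Type u) [NormedAddCommGroup X] [InnerProductSpace ℂ X]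
    [CompleteSpace X] [NormedAddCommGroup Y] [InnerProductSpace ℂ Y] [CompleteSpace Y] :
    ∃ (K : Type u) (_ : NormedAddCommGroup K) (_ : InnerProductSpace ℂ K) (_ : CompleteSpace K)
      (i : X →L[ℂ] K) (j : Y →L[ℂ] K), (∀ x, adjoint i (i x) = x) ∧ (∀ y, adjoint j (j y) = y) ∧
      (∀ y, adjoint i (j y) = 0) ∧ (∀ x, adjoint j (i x) = 0) ∧
      ∀ z, i (adjoint i z) + j (adjoint j z) = z := by
  let f := (WithLp.prodContinuousLinearEquiv 2 ℂ X Y).symm.toContinuousLinearMap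
  let i : X →L[ℂ] WithLp 2 (X × Y) := f ∘L inl ℂ X Y
  let j : Y →L[ℂ] WithLp 2 (X × Y) := f ∘L inr ℂ X Y
  have hi : ∀ z, adjoint i z = z.fst := fun z => ext_inner_left ℂ fun x => by
    rw [adjoint_inner_right, WithLp.prod_inner_apply]
    simp [i, f]
  have hj : ∀ z, adjoint j z = z.snd := fun z => ext_inner_left ℂ fun x => by
    rw [adjoint_inner_right, WithLp.prod_inner_apply]
    simp [j, f]
  refine ⟨WithLp 2 (X × Y), inferInstance, inferInstance, inferInstance, i, j,
    fun x => ?_, fun y => ?_, fun y => ?_, fun x => ?_, fun z => ?_⟩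
  · simp [hi, i, f]
  · simp [hj, j, f]
  · simp [hi, j, f]
  · simp [hj, i, f]
  · rw [hi, hj]
    apply WithLp.ofLp_injective
    ext <;> simp [i, j, f]

theorem exists_orthogonalSum₃ (X Y Z : Type u)
    [NormedAddCommGroup X] [InnerProductSpace ℂ X] [CompleteSpace X]
    [NormedAddCommGroup Y] [InnerProductSpace ℂ Y] [CompleteSpace Y]
    [NormedAddCommGroup Z] [InnerProductSpace ℂ Z] [CompleteSpace Z] :
    ∃ (K : Type u) (_ : NormedAddCommGroup K) (_ : InnerProductSpace ℂ K) (_ : CompleteSpace K)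
      (a : X →L[ℂ] K) (b : Y →L[ℂ] K) (c : Z →L[ℂ] K),
      ((∀ x, adjoint a (a x) = x) ∧ (∀ y, adjoint b (b y) = y) ∧ (∀ z, adjoint c (c z) = z)) ∧
      ((∀ y, adjoint a (b y) = 0) ∧ (∀ z, adjoint a (c z) = 0) ∧ (∀ x, adjoint b (a x) = 0) ∧
        (∀ z, adjoint b (c z) = 0) ∧ (∀ x, adjoint c (a x) = 0) ∧ (∀ y, adjoint c (b y) = 0)) ∧
      ∀ w, a (adjoint a w) + b (adjoint b w) + c (adjoint c w) = w := by
  obtain ⟨L, _, _, _, i', j', h1', h2', h3', h4', h5'⟩ := exists_orthogonalSum Y Z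
  obtain ⟨K, _, _, _, i, j, h1, h2, h3, h4, h5⟩ := exists_orthogonalSum X L
  refine ⟨K, inferInstance, inferInstance, inferInstance, i, j ∘L i', j ∘L j', ?_, ?_, fun w => ?_⟩
  · simp [adjoint_comp, h1, h2, h1', h2']
  · simp [adjoint_comp, h2, h3, h4, h3', h4']
  · simp only [adjoint_comp, comp_apply]
    rw [add_assoc, ← map_add, h5', h5]

/-- Subtracting from z both VV*z and its projection onto the closure of the range of E leaves a
vector killed by V* and E*. -/
theorem isOrthogonalSum_range {X K : Type u}
    [NormedAddCommGroup X] [InnerProductSpace ℂ X] [CompleteSpace X]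
    [NormedAddCommGroup K] [InnerProductSpace ℂ K] [CompleteSpace K]
    {V : K →L[ℂ] K} {E : X →L[ℂ] K} (hV : ∀ z, adjoint V (V z) = z)
    (hE : ∀ x, adjoint V (E x) = 0) (h : ∀ z, adjoint V z = 0 → adjoint E z = 0 → z = 0) :
    IsOrthogonalSum (LinearMap.range V.toLinearMap)
      (LinearMap.range E.toLinearMap).topologicalClosure := by
  set C := (LinearMap.range E.toLinearMap).topologicalClosure with hC
  have hle : C ≤ (LinearMap.range V.toLinearMap)ᗮ := by
    refine Submodule.topologicalClosure_minimal _ ?_ (Submodule.isClosed_orthogonal _)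
    rintro _ ⟨x, rfl⟩
    rw [Submodule.mem_orthogonal]
    rintro _ ⟨z, rfl⟩
    change inner ℂ (V z) (E x) = 0
    rw [← adjoint_inner_right, hE, inner_zero_right]
  have hker : ∀ p ∈ C, adjoint V p = 0 := fun p hp => ext_inner_left ℂ fun z => by
    rw [adjoint_inner_right, inner_zero_right]
    exact (Submodule.mem_orthogonal _ _).mp (hle hp) _ ⟨z, rfl⟩
  have : CompleteSpace C := (Submodule.isClosed_topologicalClosure _).completeSpace_coe
  refine ⟨(Submodule.isOrtho_iff_le.mpr hle).symm, ?_⟩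
  rw [Submodule.eq_top_iff']
  intro z
  let p : K := C.starProjection z
  have hpC : p ∈ C := C.starProjection_apply_mem z
  have hw : z - V (adjoint V z) - p = 0 := by
    refine h _ ?_ ?_
    · rw [map_sub, map_sub, hV, hker p hpC, sub_self, sub_zero]
    · refine ext_inner_left ℂ fun x => ?_
      have h1 : inner ℂ (E x) (z - p) = (0 : ℂ) :=
        (Submodule.mem_orthogonal _ _).mp (C.sub_starProjection_mem_orthogonal z)
          (E x) (Submodule.le_topologicalClosure _ (LinearMap.mem_range_self E.toLinearMap x))
      rw [adjoint_inner_right, inner_zero_right, sub_right_comm, inner_sub_right, h1,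
        ← adjoint_inner_left, hE, inner_zero_left, sub_zero]
  rw [sub_sub, sub_eq_zero] at hw
  rw [hw]
  exact Submodule.add_mem_sup ⟨_, rfl⟩ hpC

/-- The closure of the range of an operator, as a Hilbert space of its own. -/
theorem exists_closureRange {X K : Type u}
    [NormedAddCommGroup X] [InnerProductSpace ℂ X]
    [NormedAddCommGroup K] [InnerProductSpace ℂ K] [CompleteSpace K] (T : X →L[ℂ] K) :
    ∃ (R : Type u) (_ : NormedAddCommGroup R) (_ : InnerProductSpace ℂ R) (_ : CompleteSpace R)
      (l : R →L[ℂ] K) (F : X →L[ℂ] R), (∀ r, adjoint l (l r) = r) ∧ (∀ x, l (F x) = T x) ∧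
      ∀ r, (∀ x, inner ℂ (F x) r = (0 : ℂ)) → r = 0 := by
  let R : Submodule ℂ K := (LinearMap.range T.toLinearMap)ᗮᗮ
  have hR : ∀ x, T x ∈ R := fun x => Submodule.le_orthogonal_orthogonal _ ⟨x, rfl⟩
  refine ⟨R, inferInstance, inferInstance, inferInstance, R.subtypeL, T.codRestrict R hR,
    fun r => ext_inner_right ℂ fun y => ?_, fun x => rfl, fun r hr => ?_⟩
  · rw [adjoint_inner_left]
    rfl
  · have h1 : (r : K) ∈ (LinearMap.range T.toLinearMap)ᗮ := by
      rw [Submodule.mem_orthogonal]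
      rintro _ ⟨x, rfl⟩
      exact hr x
    exact Subtype.ext (inner_self_eq_zero.mp ((Submodule.mem_orthogonal _ _).mp r.2 _ h1))

/-- The common kernel of two operators, as a Hilbert space of its own. -/
theorem exists_commonKernel {X Y K : Type u}
    [NormedAddCommGroup X] [InnerProductSpace ℂ X] [NormedAddCommGroup Y] [InnerProductSpace ℂ Y]
    [NormedAddCommGroup K] [InnerProductSpace ℂ K] [CompleteSpace K]
    (A : K →L[ℂ] X) (B : K →L[ℂ] Y) :
    ∃ (M : Type u) (_ : NormedAddCommGroup M) (_ : InnerProductSpace ℂ M) (_ : CompleteSpace M)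
      (k : M →L[ℂ] K), (∀ m, adjoint k (k m) = m) ∧ (∀ m, A (k m) = 0) ∧ (∀ m, B (k m) = 0) ∧
      ∀ z, A z = 0 → B z = 0 → ∃ m, k m = z := by
  let M : Submodule ℂ K := LinearMap.ker A.toLinearMap ⊓ LinearMap.ker B.toLinearMap
  have hM : IsClosed (M : Set K) := A.isClosed_ker.inter B.isClosed_ker
  have : CompleteSpace M := hM.completeSpace_coe
  refine ⟨M, inferInstance, inferInstance, inferInstance, M.subtypeL,
    fun m => ext_inner_right ℂ fun y => ?_, fun m => m.2.1, fun m => m.2.2,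
    fun z hA hB => ⟨⟨z, hA, hB⟩, rfl⟩⟩
  rw [adjoint_inner_left]
  rfl

end Spaces

/-! ### The lifted modulus and the extension -/

section Modulus

variable {H₁ H₂ K₂ : Type u}
  [NormedAddCommGroup H₁] [InnerProductSpace ℂ H₁] [CompleteSpace H₁]
  [NormedAddCommGroup H₂] [InnerProductSpace ℂ H₂] [CompleteSpace H₂]
  [NormedAddCommGroup K₂] [InnerProductSpace ℂ K₂] [CompleteSpace K₂]

theorem inner_map_map_of_adjoint_apply {A : H₂ →L[ℂ] H₁} (hA : ∀ x, adjoint A (A x) = x)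
    (x y : H₂) : inner ℂ (A x) (A y) = (inner ℂ x y : ℂ) := by
  rw [← adjoint_inner_left, hA]

theorem norm_opModulus_apply (E : H₂ →L[ℂ] H₁) (x : H₂) : ‖opModulus E x‖ = ‖E x‖ := by
  have h1 : (inner ℂ (opModulus E x) (opModulus E x) : ℂ) = inner ℂ (E x) (E x) := by
    rw [(opModulus_isPositive E).isSelfAdjoint.inner_apply_comm, ← comp_apply,
      opModulus_comp_self, comp_apply, adjoint_inner_right]
  rw [inner_self_eq_norm_sq_to_K, inner_self_eq_norm_sq_to_K] at h1
  refine (sq_eq_sq₀ (norm_nonneg _) (norm_nonneg _)).mp ?_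
  apply Complex.ofReal_injective
  push_cast
  exact h1

/-- The modulus of `E` lifts to a positive operator commuting with the minimal normal
extension. -/
theorem exists_lift_opModulus {E : H₂ →L[ℂ] H₁} {S : H₂ →L[ℂ] H₂}
    (hc : S ∘L (adjoint E ∘L E) = (adjoint E ∘L E) ∘L S)
    {ι₂ : H₂ →ₗᵢ[ℂ] K₂} {N : K₂ →L[ℂ] K₂} (hN : IsMinimalNormalExtension ι₂ S N) :
    ∃ Q : K₂ →L[ℂ] K₂, 0 ≤ Q ∧ Commute Q N ∧ OpExtends ι₂ (opModulus E) Q := by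
  have h0 : 0 ≤ opModulus E := (nonneg_iff_isPositive _).mpr (opModulus_isPositive E)
  have hEE : Commute (adjoint E ∘L E) S := hc.symm
  have hq : Commute (CFC.sqrt (opModulus E)) S :=
    (show Commute (opModulus E) S from hEE.cfcₙ_nnreal _).cfcₙ_nnreal _
  -- The square root of |E| is lifted instead of |E|: the square of its selfadjoint lift is
  -- automatically positive.
  obtain ⟨T, hT, hTN, hTe⟩ := hN.exists_lift (CFC.sqrt_nonneg (opModulus E)).isSelfAdjoint hq
  refine ⟨T * T, ?_, hTN.mul_left hTN, fun x => ?_⟩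
  · simpa [hT.star_eq] using star_mul_self_nonneg T
  · rw [mul_apply_eq_comp, hTe, hTe, ← mul_apply_eq_comp, CFC.sqrt_mul_sqrt_self _ h0]

end Modulus

/-! ### Construction of the extension on H₁ ⊕ ℓ²(M) ⊕ ℓ²(R) -/

theorem corollary1p5 {H₁ H₂ K₂ : Type u}
    [NormedAddCommGroup H₁] [InnerProductSpace ℂ H₁] [CompleteSpace H₁]
    [NormedAddCommGroup H₂] [InnerProductSpace ℂ H₂] [CompleteSpace H₂]
    [NormedAddCommGroup K₂] [InnerProductSpace ℂ K₂] [CompleteSpace K₂]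
    (V : H₁ →L[ℂ] H₁) (E : H₂ →L[ℂ] H₁) (S : H₂ →L[ℂ] H₂)
    (hT : (BlockMatrix.upper V E S).IsClassS)
    (ι₂ : H₂ →ₗᵢ[ℂ] K₂) (N : K₂ →L[ℂ] K₂) (hN : IsMinimalNormalExtension ι₂ S N) :
    ∃ (K₁ : Type u) (_ : NormedAddCommGroup K₁) (_ : InnerProductSpace ℂ K₁)
      (_ : CompleteSpace K₁) (ι₁ : H₁ →ₗᵢ[ℂ] K₁) (V' : K₁ →L[ℂ] K₁) (E' : K₂ →L[ℂ] K₁),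
      (BlockMatrix.upper V' E' N).IsClassN ∧
      BlockMatrix.EntrywiseExtends ι₁ ι₂ (BlockMatrix.upper V E S)
        (BlockMatrix.upper V' E' N) ∧
      OpExtends ι₂ (opModulus E) (opModulus E') ∧
      hilbertDim K₁ = hilbertDim H₁ ∧
      hilbertDim K₂ = hilbertDim H₂ ∧
      IsOrthogonalSum (LinearMap.range V'.toLinearMap)
        (LinearMap.range E'.toLinearMap).topologicalClosure := by
  obtain ⟨⟨hH₁, hH₂, -, hVV, hVE, hSE⟩, -⟩ := hT
  simp only [BlockMatrix.upper] at hVV hVE hSE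
  have hV : ∀ x, adjoint V (V x) = x := fun x => congrArg (fun T : H₁ →L[ℂ] H₁ => T x) hVV
  have hE : ∀ x, adjoint V (E x) = 0 := fun x => congrArg (fun T : H₂ →L[ℂ] H₁ => T x) hVE
  obtain ⟨Q, hQ0, hQN, hQ⟩ := exists_lift_opModulus hSE hN
  have hQs : IsSelfAdjoint Q := hQ0.isSelfAdjoint
  have hQN' : Commute Q (adjoint N) := by
    have := hQN.star_star
    rwa [hQs.star_eq] at this
  obtain ⟨W, hW, hW', hWW, hW0⟩ := exists_partialIsometry
    (Q ∘L ι₂.toContinuousLinearMap) E fun x => by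
      rw [← norm_opModulus_apply, ← ι₂.norm_map]
      exact congrArg norm (hQ x).symm
  have hWE : ∀ x, W (Q (ι₂ x)) = E x := hW
  have hW'E : ∀ x, adjoint W (E x) = Q (ι₂ x) := hW'
  have hWz : ∀ z, (∀ x, inner ℂ (E x) z = 0) → ∀ y, (inner ℂ (W y) z : ℂ) = 0 := fun z hz y => by
    rw [← adjoint_inner_right, hW0 z hz, inner_zero_right]
  have hVW : ∀ y, adjoint V (W y) = 0 := fun y => ext_inner_right ℂ fun z => by
    rw [adjoint_inner_left, inner_zero_left]
    refine hWz _ (fun x => ?_) y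
    rw [← adjoint_inner_left, hE, inner_zero_left]
  let D : K₂ →L[ℂ] K₂ := ContinuousLinearMap.id ℂ K₂ - adjoint W ∘L W
  have hD : ∀ y, D y = y - adjoint W (W y) := fun y => rfl
  have hDQ : ∀ x, D (Q (ι₂ x)) = 0 := fun x => by rw [hD, hWE, hW'E, sub_self]
  obtain ⟨M, _, _, _, k, hk, hVk, hEk, hM⟩ := exists_commonKernel (adjoint V) (adjoint E)
  obtain ⟨R, _, _, _, l, F, hl, hlF, hF0⟩ := exists_closureRange (D ∘L Q)
  have hkV : ∀ x, adjoint k (V x) = 0 := fun x => ext_inner_right ℂ fun m => by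
    rw [adjoint_inner_left, ← adjoint_inner_right, hVk, inner_zero_right, inner_zero_left]
  have hkW : ∀ y, adjoint k (W y) = 0 := fun y => ext_inner_right ℂ fun m => by
    rw [adjoint_inner_left, inner_zero_left]
    refine hWz _ (fun x => ?_) y
    rw [← adjoint_inner_right, hEk, inner_zero_right]
  have hF : ∀ y, F y = adjoint l (D (Q y)) := fun y => by
    rw [← hl (F y), hlF, comp_apply]
  have hFι : ∀ x, F (ι₂ x) = 0 := fun x => by rw [hF, hDQ, map_zero]
  obtain ⟨LM, _, _, _, s, e, he, hss, hee, hse, hdec⟩ := exists_shift M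
  obtain ⟨LR, _, _, _, t, f, hf, htt, hff, htf, hdec'⟩ := exists_shift R
  obtain ⟨K₁, _, _, _, a, b, c, ⟨haa, hbb, hcc⟩, ⟨hab, hac, hba, hbc, hca, hcb⟩, habc⟩ :=
    exists_orthogonalSum₃ H₁ LM LR
  let ι₁ : H₁ →ₗᵢ[ℂ] K₁ := a.toLinearMap.isometryOfInner fun x y => by
    change inner ℂ (a x) (a y) = _
    rw [← adjoint_inner_left, haa]
  have hι₁ : ∀ x, ι₁ x = a x := fun x => rfl
  let V' : K₁ →L[ℂ] K₁ := a ∘L V ∘L adjoint a + a ∘L k ∘L adjoint (e 0) ∘L adjoint b +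
    b ∘L adjoint s ∘L adjoint b + c ∘L t ∘L adjoint c
  let E' : K₂ →L[ℂ] K₁ := a ∘L W ∘L Q + c ∘L f 0 ∘L F
  have hV' : ∀ z, V' z = a (V (adjoint a z)) + a (k (adjoint (e 0) (adjoint b z))) +
    b (adjoint s (adjoint b z)) + c (t (adjoint c z)) := fun z => rfl
  have hE' : ∀ y, E' y = a (W (Q y)) + c (f 0 (F y)) := fun y => rfl
  have hV'a : ∀ z, adjoint V' z = a (adjoint V (adjoint a z)) + b (e 0 (adjoint k (adjoint a z))) +
      b (s (adjoint b z)) + c (adjoint t (adjoint c z)) := fun z => by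
    simp [V', adjoint_comp]
  have hV'V' : ∀ z, adjoint V' (V' z) = z := fun z => by
    rw [hV'a, hV']
    simp only [map_add, haa, hbb, hcc, hab, hac, hba, hbc, hca, hcb, hV, hVk, hkV, hk, htt,
      add_zero, zero_add]
    rw [add_assoc (a _), ← map_add, add_comm (e 0 _), hdec, habc]
  have hV'E' : ∀ y, adjoint V' (E' y) = 0 := fun y => by
    rw [hV'a, hE']
    simp only [map_add, haa, hcc, hac, hba, hbc, hca, hVW, hkW, htf, add_zero, zero_add, map_zero]
  have hE'ι : ∀ x, E' (ι₂ x) = a (E x) := fun x => by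
    rw [hE', hFι, hWE, map_zero, map_zero, add_zero]
  -- The quadratic forms agree, as ‖WQy‖² + ‖DQy‖² = ‖Qy‖², and over ℂ they determine the operators.
  have hE'E' : adjoint E' ∘L E' = Q * Q := by
    have : (adjoint E' ∘L E').toLinearMap = (Q * Q).toLinearMap := by
      rw [← ext_inner_map]
      intro y
      change inner ℂ (adjoint E' (E' y)) y = inner ℂ (Q (Q y)) y
      rw [adjoint_inner_left, hQs.inner_apply_comm,
        ← norm_sq_add_norm_sq_of_partialIsometry hWW (Q y), ← hD, ← comp_apply D, ← hlF, hE',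
        inner_add_left, inner_add_right, inner_add_right, inner_map_map_of_adjoint_apply haa,
        inner_map_map_of_adjoint_apply hcc, inner_map_map_of_adjoint_apply (hff 0),
        inner_map_map_of_adjoint_apply hl, ← adjoint_inner_left (A := c), hca, inner_zero_left,
        ← adjoint_inner_left (A := a), hac, inner_zero_left, add_zero, zero_add]
    exact ContinuousLinearMap.coe_injective this
  have hmod : opModulus E' = Q := CFC.sqrt_unique hE'E'.symm hQ0
  have hQ0' : (∀ x, Q (ι₂ x) = 0) → Q = 0 := fun h => hN.isTotalFamily.ext fun n x => by
    have := congrArg (fun T : K₂ →L[ℂ] K₂ => T (ι₂ x)) (hQN'.pow_right n).eq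
    simp only [mul_apply_eq_comp, h, map_zero] at this
    simpa using this
  refine ⟨K₁, inferInstance, inferInstance, inferInstance, ι₁, V', E',
    ⟨⟨ι₁.injective.nontrivial, ι₂.injective.nontrivial, rfl, ?_, ?_, ?_⟩, hN.1.1⟩,
    ⟨fun x => ?_, hE'ι, fun x => (map_zero ι₂).symm, hN.1.2⟩, ?_, ?_, hN.hilbertDim_eq, ?_⟩
  · ext z
    exact hV'V' z
  · ext y
    exact hV'E' y
  · change N ∘L (adjoint E' ∘L E') = (adjoint E' ∘L E') ∘L N
    rw [hE'E']
    exact (hQN.mul_left hQN).eq.symm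
  · change V' (a x) = a (V x)
    rw [hV']
    simp [haa, hba, hca]
  · rw [hmod]
    exact hQ
  · rcases lt_or_ge (hilbertDim H₁) Cardinal.aleph0 with hlt | hge
    · have := finiteDimensional_of_hilbertDim_lt hlt
      -- An isometry of a finite-dimensional space is onto, so V* is injective; hence M = 0, E = 0,
      -- Q = 0 and R = 0.
      have hinj : Function.Injective V.toLinearMap := Function.LeftInverse.injective hV
      have hsur := LinearMap.injective_iff_surjective.mp hinj
      have hV0 : ∀ x, adjoint V x = 0 → x = 0 := fun x hx => by
        obtain ⟨y, rfl⟩ := hsur x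
        have : y = 0 := (hV y).symm.trans hx
        rw [this, map_zero]
      have hM0 : ∀ m : M, m = 0 := fun m => by
        rw [← hk m, hV0 _ (hVk m), map_zero]
      have hQz : Q = 0 := hQ0' fun x => by rw [← hW'E, hV0 _ (hE x), map_zero]
      have hR0 : ∀ r : R, r = 0 := fun r => hF0 r fun y => by
        rw [hF, hQz, zero_apply, map_zero, map_zero, inner_zero_left]
      refine (hilbertDim_congr (LinearIsometryEquiv.ofSurjective ι₁ fun z =>
        ⟨adjoint a z, ?_⟩)).symm
      conv_rhs => rw [← habc z]
      rw [he (adjoint b z) fun n m => by rw [hM0 m, map_zero, inner_zero_left],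
        hf (adjoint c z) fun n r => by rw [hR0 r, map_zero, inner_zero_left], map_zero, map_zero,
        add_zero, add_zero, hι₁]
    · refine le_antisymm ?_ (hilbertDim_le_of_isometry ι₁)
      -- All operators must start from H₁, as K₂ may have larger dimension. They reach R because
      -- DQN*ᵐh = DN*ᵐQh = DN*ᵐW*Eh for h in H₂.
      let T : Unit ⊕ ℕ ⊕ (ℕ × ℕ) → H₁ →L[ℂ] K₁ := Sum.elim (fun _ => a)
        (Sum.elim (fun n => b ∘L e n ∘L adjoint k)
          fun p => c ∘L f p.1 ∘L adjoint l ∘L D ∘L (adjoint N ^ p.2) ∘L adjoint W)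
      refine hilbertDim_le_of_isTotalFamily (T := T) (fun z hz => ?_) hge
      have h1 : adjoint a z = 0 := ext_inner_left ℂ fun x => by
        rw [adjoint_inner_right, inner_zero_right]
        exact hz (Sum.inl ()) x
      have h2 : adjoint b z = 0 := he _ fun n m => by
        have := hz (Sum.inr (Sum.inl n)) (k m)
        change inner ℂ (b (e n (adjoint k (k m)))) z = 0 at this
        rwa [hk, ← adjoint_inner_right] at this
      have h3 : adjoint c z = 0 := by
        refine hf _ fun n r => ?_
        have h4 : adjoint F (adjoint (f n) (adjoint c z)) = 0 := by
          refine hN.isTotalFamily _ fun m x => ?_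
          have := hz (Sum.inr (Sum.inr (n, m))) (E x)
          change inner ℂ (c (f n (adjoint l (D ((adjoint N ^ m) (adjoint W (E x))))))) z = 0
            at this
          have hcm := congrArg (fun T : K₂ →L[ℂ] K₂ => T (ι₂ x)) (hQN'.pow_right m).eq
          simp only [mul_apply_eq_comp] at hcm
          rw [hW'E, ← hcm, ← hF] at this
          rw [adjoint_inner_right, adjoint_inner_right, adjoint_inner_right]
          exact this
        have h5 := hF0 (adjoint (f n) (adjoint c z)) fun y => by
          rw [← adjoint_inner_right, h4, inner_zero_right]
        rw [← adjoint_inner_right, h5, inner_zero_right]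
      rw [← habc z, h1, h2, h3]
      simp
  · refine isOrthogonalSum_range hV'V' hV'E' fun z hz hz' => ?_
    rw [hV'a] at hz
    have ha := congrArg (adjoint a) hz
    have hb := congrArg (adjoint b) hz
    have hc := congrArg (adjoint c) hz
    simp only [map_add, haa, hbb, hcc, hab, hac, hba, hbc, hca, hcb, add_zero, zero_add,
      map_zero] at ha hb hc
    -- The ranges of s and e 0 are orthogonal, so both terms of `hb` vanish separately.
    have hb0 : adjoint b z = 0 := by
      have := congrArg (adjoint s) hb
      rwa [map_add, hse, hss, zero_add, map_zero] at this
    have hk0 : adjoint k (adjoint a z) = 0 := by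
      have := congrArg (adjoint (e 0)) hb
      rwa [hb0, map_zero, add_zero, hee, map_zero] at this
    have hE'z : ∀ y, inner ℂ (E' y) z = (0 : ℂ) := fun y => by
      rw [← adjoint_inner_right, hz', inner_zero_right]
    have hEa : adjoint E (adjoint a z) = 0 := ext_inner_left ℂ fun x => by
      rw [adjoint_inner_right, adjoint_inner_right, ← hE'ι, hE'z, inner_zero_right]
    have ha0 : adjoint a z = 0 := by
      obtain ⟨m, hm⟩ := hM _ ha hEa
      rw [← hm, hk] at hk0
      rw [← hm, hk0, map_zero]
    have hr0 : adjoint (f 0) (adjoint c z) = 0 := hF0 _ fun y => by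
      have := hE'z y
      rwa [hE', inner_add_left, ← adjoint_inner_right, ha0, inner_zero_right, zero_add,
        ← adjoint_inner_right, ← adjoint_inner_right] at this
    have hc0 : adjoint c z = 0 := by
      rw [← hdec' (adjoint c z), hc, hr0, map_zero, map_zero, add_zero]
    rw [← habc z, ha0, hb0, hc0]
    simp
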